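/- A (finite) contextuality scenario $H$ is a finite vertex set $V(H)$ with a set $E(H)\subseteq 2^{V(H)}$ of edges such that every vertex lies in some edge. A probabilistic model on $H$ is a map $p:V(H)\to[0,1]$ with $\sum_{v\in e}p(v)=1$ for all $e\in E(H)$. The non-orthogonality graph $\mathrm{NO}(H)$ has vertex set $V(H)$, with $u\sim v$ iff no edge of $H$ contains both $u$ and $v$. $\mathcal{CE}^1(H)$ is the set of probabilistic models $p$ on $H$ with $\sum_{v\in I}p(v)\le 1$ for every independent set $I$ of $\mathrm{NO}(H)$. The Foulis–Randall product $H_A\otimes H_B$ has vertex set $V(H_A)\times V(H_B)$, and its edges are the sets $\bigcup_{a\in e_A}\{a\}\times f(a)$ with $e_A\in E(H_A)$, $f:e_A\to E(H_B)$, and the sets $\bigcup_{b\in e_B}f(b)\times\{b\}$ with $e_B\in E(H_B)$, $f:e_B\to E(H_A)$; moreover $(p_A\otimes p_B)(a,b)=p_A(a)p_B(b)$. Let $H^{\otimes n}$ and $p^{\otimes n}$ be the $n$-fold iterated (left-bracketed) products, and let $\mathcal{CE}^\infty(H)$ be the set of probabilistic models $p$ on $H$ with $p^{\otimes n}\in\mathcal{CE}^1(H^{\otimes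 n})$ for all $n\ge 1$. **Theorem.** There are contextuality scenarios $H$ for which $\mathcal{CE}^\infty(H)$ is not convex. More precisely: 1. There are scenarios $H_A,H_B$ and models $p_A\in\mathcal{CE}^\infty(H_A)$, $p_B\in\mathcal{CE}^\infty(H_B)$ such that $p_A\otimes p_B\notin\mathcal{CE}^1(H_A\otimes H_B)$ (activation). 2. Let $H_A,H_B$ be any scenarios and $p_A\in\mathcal{CE}^\infty(H_A)$, $p_B\in\mathcal{CE}^\infty(H_B)$ any models with $p_A\otimes p_B\notin\mathcal{CE}^\infty(H_A\otimes H_B)$. Then $E(H_A)$ and $E(H_B)$ are non-empty. Let $H$ be the disjoint union of $H_A$ and $H_B$, i.e. $V(H)=V(H_A)\sqcup V(H_B)$ and $E(H)=\{e_A\sqcup e_B : e_A\in E(H_A),\ e_B\in E(H_B)\}$, and let $p_A',p_B'$ be the extensions of $p_A,p_B$ by $0$ to $V(H)$. Then $p_A',p_B'\in\mathcal{CE}^\infty(H)$, but $\tfrac12(p_A'+p_B')\notin\mathcal{CE}^\infty(H)$; in particular $\mathcal{CE}^\infty(H)$ is not convex. -/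

import Mathlib

/-- A (finite) contextuality scenario: a hypergraph on a finite vertex set whose edges cover all
vertices. Vertices are outcomes, edges are measurements. -/
structure ContextualityScenario where
  /-- the vertices (outcomes) -/
  V : Type
  [fintypeV : Fintype V]
  /-- the edges (measurements) -/
  edges : Set (Finset V)
  /-- every vertex lies in at least one edge -/
  covers : ∀ v : V, ∃ e ∈ edges, v ∈ e

namespace ContextualityScenario

attribute [instance] ContextualityScenario.fintypeV

/-- The non-orthogonality graph: `u` and `v` are adjacent iff no edge contains both. -/
def nonOrthogonalityGraph (H : ContextualityScenario) : SimpleGraph H.V where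
  Adj u v := ¬ ∃ e ∈ H.edges, u ∈ e ∧ v ∈ e
  symm := ⟨fun _ _ h ⟨e, he, hv, hu⟩ => h ⟨e, he, hu, hv⟩⟩
  loopless := ⟨fun v h => h ((H.covers v).imp fun _ he => ⟨he.1, he.2, he.2⟩)⟩

/-- The set `𝒢(H)` of probabilistic models on `H`. -/
def probModels (H : ContextualityScenario) : Set (H.V → ℝ) :=
  {p | (∀ v, p v ∈ Set.Icc (0 : ℝ) 1) ∧ ∀ e ∈ H.edges, ∑ v ∈ e, p v = 1}

/-- The set `𝒞ℰ¹(H)` of probabilistic models satisfying Consistent Exclusivity: the total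
probability of every independent set of the non-orthogonality graph is at most one. -/
def CE1 (H : ContextualityScenario) : Set (H.V → ℝ) :=
  {p | p ∈ H.probModels ∧
    ∀ I : Finset H.V, H.nonOrthogonalityGraph.IsIndepSet (I : Set H.V) → ∑ v ∈ I, p v ≤ 1}

/-- The Foulis-Randall product `H_A ⊗ H_B`. Its edges are the sets `⋃_{a ∈ e_A} {a} × f(a)` with
`e_A` an edge of `H_A` and `f : e_A → E(H_B)`, and the sets `⋃_{b ∈ e_B} f(b) × {b}` with `e_B` an
edge of `H_B` and `f : e_B → E(H_A)`. (The values of `f` outside the edge play no role.) -/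
def tensor (HA HB : ContextualityScenario) : ContextualityScenario where
  V := HA.V × HB.V
  edges :=
    {e | ∃ eA ∈ HA.edges, ∃ f : HA.V → Finset HB.V, (∀ a ∈ eA, f a ∈ HB.edges) ∧
        ∀ x : HA.V × HB.V, x ∈ e ↔ x.1 ∈ eA ∧ x.2 ∈ f x.1} ∪
    {e | ∃ eB ∈ HB.edges, ∃ f : HB.V → Finset HA.V, (∀ b ∈ eB, f b ∈ HA.edges) ∧
        ∀ x : HA.V × HB.V, x ∈ e ↔ x.2 ∈ eB ∧ x.1 ∈ f x.2}
  covers := by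
    rintro ⟨a, b⟩
    obtain ⟨eA, hA, ha⟩ := HA.covers a
    obtain ⟨eB, hB, hb⟩ := HB.covers b
    exact ⟨eA ×ˢ eB, Or.inl ⟨eA, hA, fun _ => eB, fun _ _ => hB, fun _ => Finset.mem_product⟩,
      Finset.mem_product.2 ⟨ha, hb⟩⟩

/-- The product model `(p_A ⊗ p_B)(a, b) = p_A(a) p_B(b)`. -/
def tensorModel {HA HB : ContextualityScenario} (pA : HA.V → ℝ) (pB : HB.V → ℝ) :
    (HA.tensor HB).V → ℝ :=
  fun x => pA x.1 * pB x.2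

/-- The scenario with one outcome and one measurement (the product of no scenarios). -/
def unit : ContextualityScenario where
  V := Unit
  edges := {Finset.univ}
  covers v := ⟨Finset.univ, rfl, Finset.mem_univ v⟩

/-- The `n`-fold Foulis-Randall power `H^{⊗n} = (⋯((H ⊗ H) ⊗ H) ⋯) ⊗ H`. -/
def tensorPow (H : ContextualityScenario) : ℕ → ContextualityScenario
  | 0 => unit
  | 1 => H
  | n + 2 => (tensorPow H (n + 1)).tensor H

/-- The `n`-fold power `p^{⊗n}` of a model, `(v₁, …, vₙ) ↦ p(v₁) ⋯ p(vₙ)`. -/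
def tensorPowModel {H : ContextualityScenario} (p : H.V → ℝ) : (n : ℕ) → (H.tensorPow n).V → ℝ
  | 0 => fun _ => 1
  | 1 => p
  | n + 2 => tensorModel (tensorPowModel p (n + 1)) p

/-- The set `𝒞ℰⁿ(H)`: models whose `n`-fold power satisfies Consistent Exclusivity. -/
def CE (H : ContextualityScenario) (n : ℕ) : Set (H.V → ℝ) :=
  {p | p ∈ H.probModels ∧ tensorPowModel p n ∈ (H.tensorPow n).CE1}

/-- The set `𝒞ℰ^∞(H) = ⋂ₙ 𝒞ℰⁿ(H)`, the intersection being over all `n ≥ 1`. -/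
def CEInf (H : ContextualityScenario) : Set (H.V → ℝ) :=
  ⋂ (n : ℕ) (_ : 1 ≤ n), H.CE n

/-- The disjoint union of two scenarios: the vertices are the disjoint union of the vertices, the
edges are the unions `e_A ∪ e_B` of an edge of `H_A` and an edge of `H_B`. Both scenarios need at
least one edge, since otherwise these sets do not cover the vertices. -/
def disjointUnion (HA HB : ContextualityScenario) (hA : HA.edges.Nonempty)
    (hB : HB.edges.Nonempty) : ContextualityScenario where
  V := HA.V ⊕ HB.V
  edges := {e | ∃ eA ∈ HA.edges, ∃ eB ∈ HB.edges, e = eA.disjSum eB}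
  covers := by
    rintro (a | b)
    · obtain ⟨eA, h, ha⟩ := HA.covers a
      obtain ⟨eB, h'⟩ := hB
      exact ⟨_, ⟨eA, h, eB, h', rfl⟩, Finset.inl_mem_disjSum.2 ha⟩
    · obtain ⟨eB, h, hb⟩ := HB.covers b
      obtain ⟨eA, h'⟩ := hA
      exact ⟨_, ⟨eA, h', eB, h, rfl⟩, Finset.inr_mem_disjSum.2 hb⟩

/-- Extension of a model on `H_A` by zero to the disjoint union. -/
def extendLeft {HA HB : ContextualityScenario} {hA : HA.edges.Nonempty} {hB : HB.edges.Nonempty}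
    (pA : HA.V → ℝ) : (disjointUnion HA HB hA hB).V → ℝ :=
  Sum.elim pA fun _ => 0

/-- Extension of a model on `H_B` by zero to the disjoint union. -/
def extendRight {HA HB : ContextualityScenario} {hA : HA.edges.Nonempty} {hB : HB.edges.Nonempty}
    (pB : HB.V → ℝ) : (disjointUnion HA HB hA hB).V → ℝ :=
  Sum.elim (fun _ => 0) pB

end ContextualityScenario

/-! Call two distinct outcomes orthogonal if some edge contains both. Two vertices of a
Foulis–Randall product are orthogonal iff they are so in some coordinate (`orth_tensor_iff`). Hence
membership in `CEInf` is a bound on a weighted Shannon capacity: any family of words of equal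
length, pairwise orthogonal in some letter, has total weight at most 1 (`mem_CEInf_iff`).

Mixing: suppose a family of words of length n in pairs (a, b) has total product weight s > 1. Spread
the two components of each word over 2n positions, choosing which n positions carry letters of A.
Different choices are orthogonal because every vertex of A is orthogonal to every vertex of B in the
disjoint union. If the mixture lay in `CEInf`, this would give `centralBinom n * s ≤ 4 ^ n`. The
loss is only linear in n, so applying this to powers of the family contradicts s > 1
(`CapacityLeOne.prod_of_mix`).

Activation: Haemers' rank bound certifies a capacity over any field, but certificates over different
fields need not combine. The 84 triples in a nine-point set carry one 9-dimensional certificate over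
`ZMod 2` and one over `ℚ`. Any two distinct triples are orthogonal in one of the two scenarios, so
the diagonal of the product has weight 84/81 > 1. -/

namespace ContextualityScenario

/-! ### Orthogonality and products of models -/

/-- Two distinct outcomes are orthogonal if they belong to a common measurement. -/
def Orth (H : ContextualityScenario) (u v : H.V) : Prop :=
  u ≠ v ∧ ∃ e ∈ H.edges, u ∈ e ∧ v ∈ e

theorem isIndepSet_nonOrthogonalityGraph_iff (H : ContextualityScenario) (I : Set H.V) :
    H.nonOrthogonalityGraph.IsIndepSet I ↔ I.Pairwise H.Orth := by
  constructor
  · intro h u hu v hv huv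
    exact ⟨huv, not_not.1 (h hu hv huv)⟩
  · intro h u hu v hv huv
    exact not_not.2 (h hu hv huv).2

/-- For the converse, the edge may steer the second measurement by the first outcome: since the
first outcomes differ, edges through the two second outcomes can be assigned to them independently.
-/
theorem orth_tensor_iff (HA HB : ContextualityScenario) (x y : (HA.tensor HB).V) :
    (HA.tensor HB).Orth x y ↔ HA.Orth x.1 y.1 ∨ HB.Orth x.2 y.2 := by
  classical
  obtain ⟨a, b⟩ := x
  obtain ⟨a', b'⟩ := y
  constructor
  · rintro ⟨hne, e, he | he, hx, hy⟩
    · obtain ⟨eA, hA, f, hf, hmem⟩ := he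
      have h1 := (hmem _).1 hx
      have h2 := (hmem _).1 hy
      by_cases h : a = a'
      · subst h
        exact Or.inr ⟨fun hb => hne (congrArg (Prod.mk a) hb), f a, hf a h1.1, h1.2, h2.2⟩
      · exact Or.inl ⟨h, eA, hA, h1.1, h2.1⟩
    · obtain ⟨eB, hB, f, hf, hmem⟩ := he
      have h1 := (hmem _).1 hx
      have h2 := (hmem _).1 hy
      by_cases h : b = b'
      · subst h
        exact Or.inl ⟨fun ha => hne (congrArg (fun c => (c, b)) ha), f b, hf b h1.1, h1.2, h2.2⟩
      · exact Or.inr ⟨h, eB, hB, h1.1, h2.1⟩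
  · rintro (⟨hne, eA, hA, h1, h2⟩ | ⟨hne, eB, hB, h1, h2⟩)
    · obtain ⟨e, he, hb⟩ := HB.covers b
      obtain ⟨e', he', hb'⟩ := HB.covers b'
      refine ⟨fun h => hne (congrArg Prod.fst h),
        Finset.univ.filter fun x : HA.V × HB.V => x.1 ∈ eA ∧ x.2 ∈ if x.1 = a then e else e',
        Or.inl ⟨eA, hA, fun c => if c = a then e else e', fun c _ => ?_, fun x => ?_⟩, ?_, ?_⟩
      · dsimp only; split_ifs <;> assumption
      · exact Finset.mem_filter.trans (and_iff_right (Finset.mem_univ _))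
      · exact Finset.mem_filter.2 ⟨Finset.mem_univ _, h1, by simpa using hb⟩
      · exact Finset.mem_filter.2 ⟨Finset.mem_univ _, h2, by simpa [Ne.symm hne] using hb'⟩
    · obtain ⟨e, he, hb⟩ := HA.covers a
      obtain ⟨e', he', hb'⟩ := HA.covers a'
      refine ⟨fun h => hne (congrArg Prod.snd h),
        Finset.univ.filter fun x : HA.V × HB.V => x.2 ∈ eB ∧ x.1 ∈ if x.2 = b then e else e',
        Or.inr ⟨eB, hB, fun c => if c = b then e else e', fun c _ => ?_, fun x => ?_⟩, ?_, ?_⟩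
      · dsimp only; split_ifs <;> assumption
      · exact Finset.mem_filter.trans (and_iff_right (Finset.mem_univ _))
      · exact Finset.mem_filter.2 ⟨Finset.mem_univ _, h1, by simpa using hb⟩
      · exact Finset.mem_filter.2 ⟨Finset.mem_univ _, h2, by simpa [Ne.symm hne] using hb'⟩

theorem tensorModel_mem_probModels {HA HB : ContextualityScenario} {pA : HA.V → ℝ}
    {pB : HB.V → ℝ} (hA : pA ∈ HA.probModels) (hB : pB ∈ HB.probModels) :
    tensorModel pA pB ∈ (HA.tensor HB).probModels := by
  refine ⟨fun x => ⟨mul_nonneg (hA.1 _).1 (hB.1 _).1,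
    mul_le_one₀ (hA.1 _).2 (hB.1 _).1 (hB.1 _).2⟩, ?_⟩
  rintro e (⟨eA, he, f, hf, hmem⟩ | ⟨eB, he, f, hf, hmem⟩)
  · refine (Finset.sum_finset_product e eA f hmem).trans ?_
    rw [← hA.2 eA he]
    refine Finset.sum_congr rfl fun a ha => ?_
    simp only [tensorModel]
    rw [← Finset.mul_sum, hB.2 _ (hf a ha), mul_one]
  · refine (Finset.sum_finset_product_right e eB f hmem).trans ?_
    rw [← hB.2 eB he]
    refine Finset.sum_congr rfl fun b hb => ?_
    simp only [tensorModel]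
    rw [← Finset.sum_mul, hA.2 _ (hf b hb), one_mul]

theorem tensorPowModel_mem_probModels {H : ContextualityScenario} {p : H.V → ℝ}
    (hp : p ∈ H.probModels) : ∀ n, tensorPowModel p n ∈ (H.tensorPow n).probModels
  | 0 => ⟨fun _ => ⟨zero_le_one, le_rfl⟩, by
      rintro e rfl
      exact Fintype.sum_unique (ι := Unit) _⟩
  | 1 => hp
  | n + 2 => tensorModel_mem_probModels (tensorPowModel_mem_probModels hp (n + 1)) hp

/-! ### Words and weighted Shannon capacity -/

/-- The word of outcomes that a vertex of `H^{⊗n}` stands for. -/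
def coords (H : ContextualityScenario) : (n : ℕ) → (H.tensorPow n).V → Fin n → H.V
  | 0 => fun _ i => i.elim0
  | 1 => fun v _ => v
  | n + 2 => fun x => Fin.snoc (coords H (n + 1) x.1) x.2

theorem coords_surjective (H : ContextualityScenario) : ∀ n, Function.Surjective (H.coords n)
  | 0 => fun _ => ⟨(), funext fun i => i.elim0⟩
  | 1 => fun u => ⟨u 0, funext fun i => congrArg u (Subsingleton.elim _ _)⟩
  | n + 2 => fun u => by
      obtain ⟨x, hx⟩ := coords_surjective H (n + 1) (Fin.init u)
      refine ⟨(x, u (Fin.last _)), ?_⟩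
      simp only [coords, hx, Fin.snoc_init_self]

theorem orth_tensorPow_iff (H : ContextualityScenario) : ∀ (n : ℕ) (x y : (H.tensorPow n).V),
    (H.tensorPow n).Orth x y ↔ ∃ i, H.Orth (H.coords n x i) (H.coords n y i)
  | 0, _, _ => ⟨fun h => (h.1 rfl).elim, fun ⟨i, _⟩ => i.elim0⟩
  | 1, _, _ => ⟨fun h => ⟨0, h⟩, fun ⟨_, h⟩ => h⟩
  | n + 2, x, y => by
      refine (orth_tensor_iff _ _ x y).trans ?_
      rw [orth_tensorPow_iff H (n + 1)]
      refine Iff.trans ?_ Fin.exists_fin_succ'.symm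
      simp only [coords, Fin.snoc_castSucc, Fin.snoc_last]

theorem tensorPowModel_eq_prod {H : ContextualityScenario} (p : H.V → ℝ) :
    ∀ (n : ℕ) (x : (H.tensorPow n).V), tensorPowModel p n x = ∏ i, p (H.coords n x i)
  | 0, _ => rfl
  | 1, _ => by simp [tensorPowModel, coords]
  | n + 2, x => by
      rw [Fin.prod_univ_castSucc]
      simp only [coords, Fin.snoc_castSucc, Fin.snoc_last]
      rw [← tensorPowModel_eq_prod p (n + 1)]
      rfl

/-- Every family of words that are pairwise related in some letter has total weight at most one:
the weighted Shannon capacity of the complement of `R` is at most one. -/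
def CapacityLeOne {V : Type} (R : V → V → Prop) (p : V → ℝ) : Prop :=
  ∀ (κ ι : Type) [Fintype κ] [Fintype ι] (u : κ → ι → V),
    (Pairwise fun j k => ∃ i, R (u j i) (u k i)) → ∑ j, ∏ i, p (u j i) ≤ 1

theorem mem_CEInf_iff {H : ContextualityScenario} {p : H.V → ℝ} :
    p ∈ H.CEInf ↔ p ∈ H.probModels ∧ CapacityLeOne H.Orth p := by
  classical
  simp only [CEInf, Set.mem_iInter]
  constructor
  · intro h
    refine ⟨(h 1 le_rfl).1, fun κ ι _ _ u hu => ?_⟩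
    -- `CEInf` only involves powers n ≥ 1, so length 0 is separate: empty words are never related,
    -- hence there is at most one, of weight 1.
    rcases isEmpty_or_nonempty ι with hι | hι
    · have hκ : Subsingleton κ := ⟨fun j k => by
        by_contra hjk
        obtain ⟨i, -⟩ := hu hjk
        exact hι.elim i⟩
      simpa using Fintype.card_le_one_iff_subsingleton.2 hκ
    · set n := Fintype.card ι
      have e : ι ≃ Fin n := Fintype.equivFin ι
      choose x hx using fun j => H.coords_surjective n (u j ∘ e.symm)
      have hor : ∀ j k, j ≠ k → (H.tensorPow n).Orth (x j) (x k) := fun j k hjk => by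
        rw [orth_tensorPow_iff, hx, hx]
        obtain ⟨i, hi⟩ := hu hjk
        exact ⟨e i, by simpa using hi⟩
      -- Orthogonality includes distinctness, so the family is a genuine set of vertices and no
      -- weight is lost in passing to its image.
      have hinj : Function.Injective x := fun j k hjk => by
        by_contra hne
        exact (hor j k hne).1 hjk
      have key := (h n Fintype.card_pos).2.2 (Finset.univ.image x) (by
        rw [isIndepSet_nonOrthogonalityGraph_iff]
        rintro a ha b hb hab
        obtain ⟨j, -, rfl⟩ := Finset.mem_image.1 (Finset.mem_coe.1 ha)
        obtain ⟨k, -, rfl⟩ := Finset.mem_image.1 (Finset.mem_coe.1 hb)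
        exact hor j k fun h => hab (congrArg x h))
      rw [Finset.sum_image fun _ _ _ _ hjk => hinj hjk] at key
      refine le_trans (le_of_eq (Finset.sum_congr rfl fun j _ => ?_)) key
      rw [tensorPowModel_eq_prod, hx]
      exact Fintype.prod_equiv e _ _ fun i => by simp
  · rintro ⟨hp, h⟩ n -
    refine ⟨hp, tensorPowModel_mem_probModels hp n, fun I hI => ?_⟩
    rw [isIndepSet_nonOrthogonalityGraph_iff] at hI
    have key := h I (Fin n) (fun x => H.coords n x) fun x y hxy =>
      (orth_tensorPow_iff H n _ _).1 (hI x.2 y.2 fun h => hxy (Subtype.ext h))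
    rw [← Finset.sum_coe_sort]
    simpa only [tensorPowModel_eq_prod] using key

theorem CEInf_subset_CE1 (H : ContextualityScenario) : H.CEInf ⊆ H.CE1 := fun _ hp =>
  (Set.mem_iInter₂.1 hp 1 le_rfl).2

/-! ### Disjoint unions -/

section DisjointUnion

variable {HA HB : ContextualityScenario} {hA : HA.edges.Nonempty} {hB : HB.edges.Nonempty}

theorem orth_disjointUnion_inl_inl {a a' : HA.V} :
    (disjointUnion HA HB hA hB).Orth (Sum.inl a) (Sum.inl a') ↔ HA.Orth a a' := by
  constructor
  · rintro ⟨hne, e, ⟨eA, h, eB, h', rfl⟩, h1, h2⟩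
    exact ⟨fun h => hne (congrArg _ h), eA, h, Finset.inl_mem_disjSum.1 h1,
      Finset.inl_mem_disjSum.1 h2⟩
  · rintro ⟨hne, eA, h, h1, h2⟩
    obtain ⟨eB, h'⟩ := hB
    exact ⟨fun h => hne (Sum.inl_injective h), _, ⟨eA, h, eB, h', rfl⟩,
      Finset.inl_mem_disjSum.2 h1, Finset.inl_mem_disjSum.2 h2⟩

theorem orth_disjointUnion_inr_inr {b b' : HB.V} :
    (disjointUnion HA HB hA hB).Orth (Sum.inr b) (Sum.inr b') ↔ HB.Orth b b' := by
  constructor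
  · rintro ⟨hne, e, ⟨eA, h, eB, h', rfl⟩, h1, h2⟩
    exact ⟨fun h => hne (congrArg _ h), eB, h', Finset.inr_mem_disjSum.1 h1,
      Finset.inr_mem_disjSum.1 h2⟩
  · rintro ⟨hne, eB, h, h1, h2⟩
    obtain ⟨eA, h'⟩ := hA
    exact ⟨fun h => hne (Sum.inr_injective h), _, ⟨eA, h', eB, h, rfl⟩,
      Finset.inr_mem_disjSum.2 h1, Finset.inr_mem_disjSum.2 h2⟩

theorem orth_disjointUnion_inl_inr (a : HA.V) (b : HB.V) :
    (disjointUnion HA HB hA hB).Orth (Sum.inl a) (Sum.inr b) := by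
  obtain ⟨eA, h, ha⟩ := HA.covers a
  obtain ⟨eB, h', hb⟩ := HB.covers b
  exact ⟨Sum.inl_ne_inr, _, ⟨eA, h, eB, h', rfl⟩, Finset.inl_mem_disjSum.2 ha,
    Finset.inr_mem_disjSum.2 hb⟩

theorem orth_disjointUnion_inr_inl (a : HA.V) (b : HB.V) :
    (disjointUnion HA HB hA hB).Orth (Sum.inr b) (Sum.inl a) := by
  obtain ⟨h, e, he, h1, h2⟩ := orth_disjointUnion_inl_inr (hA := hA) (hB := hB) a b
  exact ⟨h.symm, e, he, h2, h1⟩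

end DisjointUnion

/-- Extending weights by zero does not affect the capacity bound. -/
theorem CapacityLeOne.of_extend_zero {V W : Type} {R : V → V → Prop} {S : W → W → Prop}
    {p : V → ℝ} {q : W → ℝ} (f : V → W) (hp : CapacityLeOne R p)
    (hS : ∀ a b, S (f a) (f b) → R a b) (hq : ∀ a, q (f a) = p a)
    (hq0 : ∀ w, w ∉ Set.range f → q w = 0) : CapacityLeOne S q := by
  classical
  intro κ ι _ _ u hu
  set P : κ → Prop := fun j => ∀ i, u j i ∈ Set.range f
  choose g hg using fun j : {j // P j} => j.2
  have key := hp {j // P j} ι g fun j k hjk => by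
    obtain ⟨i, hi⟩ := hu fun h : j.1 = k.1 => hjk (Subtype.ext h)
    refine ⟨i, hS _ _ ?_⟩
    rw [hg, hg]
    exact hi
  refine le_trans (le_of_eq ?_) key
  -- A word with a letter outside the range of `f` has weight zero; the others lift to words over
  -- `V`.
  have hzero : ∀ j ∈ Finset.univ, ∏ i, q (u j i) ≠ 0 → P j := fun j _ hj i => by
    by_contra hi
    exact hj (Finset.prod_eq_zero (Finset.mem_univ i) (hq0 _ hi))
  rw [← Finset.sum_filter_of_ne hzero, ← Finset.sum_subtype_eq_sum_filter,
    Finset.subtype_univ]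
  refine Finset.sum_congr rfl fun j _ => Finset.prod_congr rfl fun i _ => ?_
  rw [← hq, hg]

theorem extendLeft_mem_CEInf {HA HB : ContextualityScenario} {hA : HA.edges.Nonempty}
    {hB : HB.edges.Nonempty} {pA : HA.V → ℝ} (hp : pA ∈ HA.CEInf) :
    extendLeft pA ∈ (disjointUnion HA HB hA hB).CEInf := by
  rw [mem_CEInf_iff] at hp ⊢
  refine ⟨⟨?_, ?_⟩, hp.2.of_extend_zero Sum.inl (fun _ _ => orth_disjointUnion_inl_inl.1)
    (fun _ => rfl) ?_⟩
  · rintro (a | b)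
    · exact hp.1.1 a
    · exact ⟨le_rfl, zero_le_one⟩
  · rintro e ⟨eA, h, eB, h', rfl⟩
    refine (Finset.sum_disjSum _ _ _).trans ?_
    simpa [extendLeft] using hp.1.2 eA h
  · rintro (a | b) h
    · exact (h ⟨a, rfl⟩).elim
    · rfl

theorem extendRight_mem_CEInf {HA HB : ContextualityScenario} {hA : HA.edges.Nonempty}
    {hB : HB.edges.Nonempty} {pB : HB.V → ℝ} (hp : pB ∈ HB.CEInf) :
    extendRight pB ∈ (disjointUnion HA HB hA hB).CEInf := by
  rw [mem_CEInf_iff] at hp ⊢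
  refine ⟨⟨?_, ?_⟩, hp.2.of_extend_zero Sum.inr (fun _ _ => orth_disjointUnion_inr_inr.1)
    (fun _ => rfl) ?_⟩
  · rintro (a | b)
    · exact ⟨le_rfl, zero_le_one⟩
    · exact hp.1.1 b
  · rintro e ⟨eA, h, eB, h', rfl⟩
    refine (Finset.sum_disjSum _ _ _).trans ?_
    simpa [extendRight] using hp.1.2 eB h'
  · rintro (a | b) h
    · rfl
    · exact (h ⟨b, rfl⟩).elim

/-! ### Interleaving and the half-half mixture -/

/-- A family of words of pairs gives, for each way of interleaving the two words of a pair, a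
family of words of twice the length. -/
theorem centralBinom_mul_sum_le {A B : Type} {RA : A → A → Prop} {RB : B → B → Prop}
    {S : A ⊕ B → A ⊕ B → Prop} {pA : A → ℝ} {pB : B → ℝ} {q : A ⊕ B → ℝ}
    (hll : ∀ a a', RA a a' → S (Sum.inl a) (Sum.inl a'))
    (hrr : ∀ b b', RB b b' → S (Sum.inr b) (Sum.inr b'))
    (hlr : ∀ a b, S (Sum.inl a) (Sum.inr b)) (hrl : ∀ a b, S (Sum.inr b) (Sum.inl a))
    (hqA : ∀ a, q (Sum.inl a) = 1 / 2 * pA a) (hqB : ∀ b, q (Sum.inr b) = 1 / 2 * pB b)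
    (hq : CapacityLeOne S q) {κ : Type} [Fintype κ] (n : ℕ) (u : κ → Fin n → A × B)
    (hu : Pairwise fun j k => ∃ i, RA (u j i).1 (u k i).1 ∨ RB (u j i).2 (u k i).2) :
    (n.centralBinom : ℝ) * ∑ j, ∏ i, pA (u j i).1 * pB (u j i).2 ≤ 4 ^ n := by
  classical
  -- The n positions among 2n that carry letters of A.
  let C := {c : Finset (Fin (2 * n)) // c.card = n}
  have e₁ : ∀ c : C, {x // x ∈ c.1} ≃ Fin n := fun c => Fintype.equivFinOfCardEq (by simp [c.2])
  have e₂ : ∀ c : C, {x // ¬ x ∈ c.1} ≃ Fin n := fun c => Fintype.equivFinOfCardEq (by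
    rw [Fintype.card_subtype_compl]
    simp [c.2]
    omega)
  let w : C × κ → Fin (2 * n) → A ⊕ B := fun t x =>
    if h : x ∈ t.1.1 then Sum.inl (u t.2 (e₁ t.1 ⟨x, h⟩)).1 else
      Sum.inr (u t.2 (e₂ t.1 ⟨x, h⟩)).2
  have key := hq (C × κ) (Fin (2 * n)) w (by
    rintro ⟨c, j⟩ ⟨d, k⟩ hne
    -- With equal position sets, the relation comes from the original words. Otherwise some position
    -- holds a letter of A in one word and of B in the other.
    by_cases hcd : c = d
    · subst hcd
      obtain ⟨i, hi | hi⟩ := hu fun h : j = k => hne (by rw [h])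
      · refine ⟨((e₁ c).symm i).1, ?_⟩
        have h := ((e₁ c).symm i).2
        simp only [w, dif_pos h]
        exact hll _ _ (by simpa using hi)
      · refine ⟨((e₂ c).symm i).1, ?_⟩
        have h := ((e₂ c).symm i).2
        simp only [w, dif_neg h]
        exact hrr _ _ (by simpa using hi)
    · have : ∃ x, ¬ (x ∈ c.1 ↔ x ∈ d.1) := by
        by_contra! h
        exact hcd (Subtype.ext (Finset.ext h))
      obtain ⟨x, hx⟩ := this
      refine ⟨x, ?_⟩
      by_cases h1 : x ∈ c.1 <;> by_cases h2 : x ∈ d.1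
      · exact (hx (by simp [h1, h2])).elim
      · simp only [w, dif_pos h1, dif_neg h2]
        exact hlr _ _
      · simp only [w, dif_neg h1, dif_pos h2]
        exact hrl _ _
      · exact (hx (by simp [h1, h2])).elim)
  -- Each of the 2n letters contributes a factor 1/2, whatever the interleaving.
  have hprod : ∀ t : C × κ,
      ∏ x, q (w t x) = (1 / 4) ^ n * ∏ i, pA (u t.2 i).1 * pB (u t.2 i).2 := by
    rintro ⟨c, j⟩
    have h1 (_ : Fintype {x // x ∈ c.1}) :
        ∏ x : {x // x ∈ c.1}, q (w (c, j) x) = ∏ i : Fin n, (1 / 2 * pA (u j i).1) :=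
      Fintype.prod_equiv (e₁ c) _ _ fun x => by
        simp only [w, dif_pos x.2]
        exact hqA _
    have h2 (_ : Fintype {x // ¬ x ∈ c.1}) :
        ∏ x : {x // ¬ x ∈ c.1}, q (w (c, j) x) = ∏ i : Fin n, (1 / 2 * pB (u j i).2) :=
      Fintype.prod_equiv (e₂ c) _ _ fun x => by
        simp only [w, dif_neg x.2]
        exact hqB _
    rw [← Fintype.prod_subtype_mul_prod_subtype (fun x => x ∈ c.1), h1, h2]
    rw [Finset.prod_mul_distrib, Finset.prod_mul_distrib, Finset.prod_mul_distrib,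
      Finset.prod_const, Finset.card_univ, Fintype.card_fin]
    rw [show (1 / 4 : ℝ) = 1 / 2 * (1 / 2) by norm_num, mul_pow]
    ring
  have hC : Fintype.card C = n.centralBinom := by
    rw [Fintype.card_finset_len, Fintype.card_fin, Nat.centralBinom]
  simp only [hprod] at key
  rw [Fintype.sum_prod_type] at key
  simp only [Finset.sum_const, Finset.card_univ, hC, nsmul_eq_mul, ← Finset.mul_sum] at key
  have h4 : (0 : ℝ) < 4 ^ n := by positivity
  rw [one_div, inv_pow, mul_left_comm] at key
  rwa [inv_mul_le_iff₀ h4, mul_one] at key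

/-- The half-half mixture has capacity at most one only if the product has. -/
theorem CapacityLeOne.prod_of_mix {A B : Type} {RA : A → A → Prop} {RB : B → B → Prop}
    {S : A ⊕ B → A ⊕ B → Prop} {pA : A → ℝ} {pB : B → ℝ} {q : A ⊕ B → ℝ}
    (hll : ∀ a a', RA a a' → S (Sum.inl a) (Sum.inl a'))
    (hrr : ∀ b b', RB b b' → S (Sum.inr b) (Sum.inr b'))
    (hlr : ∀ a b, S (Sum.inl a) (Sum.inr b)) (hrl : ∀ a b, S (Sum.inr b) (Sum.inl a))
    (hqA : ∀ a, q (Sum.inl a) = 1 / 2 * pA a) (hqB : ∀ b, q (Sum.inr b) = 1 / 2 * pB b)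
    (hq : CapacityLeOne S q) :
    CapacityLeOne (fun x y : A × B => RA x.1 y.1 ∨ RB x.2 y.2) (fun x => pA x.1 * pB x.2) := by
  classical
  intro κ ι _ _ u hu
  set s := ∑ j, ∏ i, pA (u j i).1 * pB (u j i).2 with hs
  by_contra! hlt
  rcases isEmpty_or_nonempty ι with hι | hι
  · have hκ : Subsingleton κ := ⟨fun j k => by
      by_contra hjk
      obtain ⟨i, -⟩ := hu hjk
      exact hι.elim i⟩
    refine hlt.not_ge ?_
    simpa [hs] using Fintype.card_le_one_iff_subsingleton.2 hκ
  set d := Fintype.card ι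
  have hd : 0 < d := Fintype.card_pos
  -- The m-fold power of the family has words of length `d * m` and total weight `s ^ m`; the factor
  -- `2 * (d * m)` comes from `4 ^ N ≤ 2 * N * centralBinom N`.
  have hbound : ∀ m : ℕ, 0 < m → s ^ m ≤ 2 * (d * m : ℕ) := fun m hm => by
    have hcard : Fintype.card (Fin m × ι) = d * m := by
      simp [d, mul_comm]
    have e : Fin m × ι ≃ Fin (d * m) := Fintype.equivFinOfCardEq hcard
    have key := centralBinom_mul_sum_le hll hrr hlr hrl hqA hqB hq (κ := Fin m → κ) (d * m)
      (fun f x => u (f (e.symm x).1) (e.symm x).2) (fun f g hfg => by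
        obtain ⟨t, ht⟩ := Function.ne_iff.1 hfg
        obtain ⟨i, hi⟩ := hu ht
        exact ⟨e (t, i), by simpa using hi⟩)
    have hsum : ∑ f : Fin m → κ, ∏ x : Fin (d * m), pA (u (f (e.symm x).1) (e.symm x).2).1 *
        pB (u (f (e.symm x).1) (e.symm x).2).2 = s ^ m := by
      have : s ^ m = ∏ _t : Fin m, s := by simp
      rw [this, hs, Finset.prod_univ_sum, Fintype.piFinset_univ]
      refine Finset.sum_congr rfl fun f _ => ?_
      rw [← Fintype.prod_prod_type']
      exact Fintype.prod_equiv e.symm _ _ fun x => rfl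
    rw [hsum] at key
    have hpos : 0 < d * m := Nat.mul_pos hd hm
    have h4 : (4 : ℝ) ^ (d * m) ≤ 2 * (d * m : ℕ) * ((d * m).centralBinom : ℝ) := by
      exact_mod_cast Nat.four_pow_le_two_mul_self_mul_centralBinom (d * m) hpos
    have hcb : (0 : ℝ) < (d * m).centralBinom := by exact_mod_cast Nat.centralBinom_pos _
    refine le_of_mul_le_mul_left (key.trans (h4.trans (le_of_eq (mul_comm _ _)))) hcb
  -- Exponential growth of `s ^ m` beats the linear bound.
  have hlim := tendsto_pow_const_div_const_pow_of_one_lt 1 hlt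
  have hd' : (0 : ℝ) < 1 / (2 * d) := by positivity
  obtain ⟨m, hm, hm0⟩ := ((hlim.eventually_lt_const hd').and (Filter.eventually_gt_atTop 0)).exists
  have hsm : 0 < s ^ m := pow_pos (zero_lt_one.trans hlt) m
  rw [pow_one, div_lt_div_iff₀ hsm (by positivity), one_mul] at hm
  have := hbound m hm0
  push_cast at this
  linarith

theorem mix_notMem_CEInf {HA HB : ContextualityScenario} {hA : HA.edges.Nonempty}
    {hB : HB.edges.Nonempty} {pA : HA.V → ℝ} {pB : HB.V → ℝ} (hpA : pA ∈ HA.CEInf)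
    (hpB : pB ∈ HB.CEInf) (h : tensorModel pA pB ∉ (HA.tensor HB).CEInf) :
    (1 / 2 : ℝ) • (extendLeft pA + extendRight pB) ∉ (disjointUnion HA HB hA hB).CEInf := by
  intro hq
  refine h (mem_CEInf_iff.2 ⟨tensorModel_mem_probModels (mem_CEInf_iff.1 hpA).1
    (mem_CEInf_iff.1 hpB).1, ?_⟩)
  have key := CapacityLeOne.prod_of_mix (RA := HA.Orth) (RB := HB.Orth) (pA := pA) (pB := pB)
    (fun _ _ => orth_disjointUnion_inl_inl.2) (fun _ _ => orth_disjointUnion_inr_inr.2)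
    orth_disjointUnion_inl_inr orth_disjointUnion_inr_inl
    (fun a => congrArg (1 / 2 * ·) (add_zero (pA a))) (fun b => congrArg (1 / 2 * ·) (zero_add (pB b)))
    (mem_CEInf_iff.1 hq).2
  intro κ ι _ _ u hu
  exact key κ ι u fun j k hjk => (hu hjk).imp fun i => (orth_tensor_iff _ _ _ _).1

theorem not_convex_CEInf_of_mix {H : ContextualityScenario} {p q : H.V → ℝ} (hp : p ∈ H.CEInf)
    (hq : q ∈ H.CEInf) (h : (1 / 2 : ℝ) • (p + q) ∉ H.CEInf) : ¬ Convex ℝ H.CEInf := fun hc =>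
  h (by
    rw [smul_add]
    exact hc hp hq (by norm_num) (by norm_num) (by norm_num))

theorem mem_CEInf_of_isEmpty {H : ContextualityScenario} [IsEmpty H.V] {p : H.V → ℝ}
    (hp : p ∈ H.probModels) : p ∈ H.CEInf := by
  refine mem_CEInf_iff.2 ⟨hp, fun κ ι _ _ u hu => ?_⟩
  rcases isEmpty_or_nonempty κ with hκ | ⟨⟨j⟩⟩
  · simp
  · have hι : IsEmpty ι := ⟨fun i => isEmptyElim (u j i)⟩
    have hκ : Subsingleton κ := ⟨fun j k => by
      by_contra hjk
      obtain ⟨i, -⟩ := hu hjk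
      exact hι.elim i⟩
    simpa using Fintype.card_le_one_iff_subsingleton.2 hκ

/-- Without vertices the product has only empty words and `CEInf` holds trivially; so both factors
have vertices, and edges cover them. -/
theorem edges_nonempty_of_tensorModel_notMem {HA HB : ContextualityScenario} {pA : HA.V → ℝ}
    {pB : HB.V → ℝ} (hpA : pA ∈ HA.CEInf) (hpB : pB ∈ HB.CEInf)
    (h : tensorModel pA pB ∉ (HA.tensor HB).CEInf) :
    HA.edges.Nonempty ∧ HB.edges.Nonempty := by
  have hV : Nonempty (HA.V × HB.V) := by
    by_contra hV
    have : IsEmpty (HA.tensor HB).V := not_nonempty_iff.1 hV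
    exact h (mem_CEInf_of_isEmpty (tensorModel_mem_probModels (mem_CEInf_iff.1 hpA).1
      (mem_CEInf_iff.1 hpB).1))
  obtain ⟨a, b⟩ := hV
  obtain ⟨eA, hA, -⟩ := HA.covers a
  obtain ⟨eB, hB, -⟩ := HB.covers b
  exact ⟨⟨eA, hA⟩, ⟨eB, hB⟩⟩

/-! ### Haemers' bound -/

/-- The identity matrix of size `S` factors through dimension `D`, so its rank is at most `card D`.
-/
theorem card_le_card_of_biorthogonal {F S D : Type*} [Field F] [Fintype S] [Fintype D]
    [DecidableEq S] (x y : S → D → F)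
    (h : ∀ i j, ∑ d, x i d * y j d = if i = j then 1 else 0) :
    Fintype.card S ≤ Fintype.card D := by
  have hXY : Matrix.of x * (Matrix.of y).transpose = 1 := by
    ext i j
    simp [Matrix.mul_apply, h, Matrix.one_apply]
  calc Fintype.card S = (1 : Matrix S S F).rank := Matrix.rank_one.symm
    _ ≤ (Matrix.of x).rank := hXY ▸ Matrix.rank_mul_le_left _ _
    _ ≤ Fintype.card D := Matrix.rank_le_card_width _

/-- Haemers' bound, with a weight proportional to the number of vectors at a vertex. -/
theorem capacityLeOne_of_biorthogonal {F V D : Type} [Field F] [Fintype D]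
    {R : V → V → Prop} (k : V → ℕ) (x y : (v : V) → Fin (k v) → D → F)
    (hself : ∀ v i j, ∑ d, x v i d * y v j d = if i = j then 1 else 0)
    (horth : ∀ u v, R u v → ∀ i j, ∑ d, x u i d * y v j d = 0) :
    CapacityLeOne R fun v => (k v : ℝ) / Fintype.card D := by
  classical
  intro κ ι _ _ u hu
  -- Tensor products of the vectors along each word form a biorthogonal system: pairings factor over
  -- letters, and one related letter makes the pairing vanish.
  let X : (Σ j, ∀ i, Fin (k (u j i))) → (ι → D) → F := fun s d => ∏ i, x (u s.1 i) (s.2 i) (d i)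
  let Y : (Σ j, ∀ i, Fin (k (u j i))) → (ι → D) → F := fun s d => ∏ i, y (u s.1 i) (s.2 i) (d i)
  have hXY : ∀ s t, ∑ d, X s d * Y t d =
      ∏ i, ∑ d, x (u s.1 i) (s.2 i) d * y (u t.1 i) (t.2 i) d := fun s t => by
    rw [Finset.prod_univ_sum, Fintype.piFinset_univ]
    exact Finset.sum_congr rfl fun d _ => Finset.prod_mul_distrib.symm
  have hcard := card_le_card_of_biorthogonal X Y (by
    rintro ⟨j, s⟩ ⟨j', t⟩
    rw [hXY]
    by_cases hj : j = j'
    · subst hj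
      simp only [hself, Finset.prod_ite_zero, Finset.prod_const_one, Finset.mem_univ,
        true_implies, Sigma.mk.injEq, heq_eq_eq, true_and, funext_iff]
    · obtain ⟨i, hi⟩ := hu hj
      rw [if_neg fun h => hj (congrArg Sigma.fst h)]
      exact Finset.prod_eq_zero (Finset.mem_univ i) (horth _ _ hi _ _))
  rw [Fintype.card_sigma, Fintype.card_fun] at hcard
  simp only [Fintype.card_pi, Fintype.card_fin] at hcard
  simp only [Finset.prod_div_distrib, ← Finset.sum_div, Finset.prod_const, Finset.card_univ]
  refine div_le_one_of_le₀ ?_ (by positivity)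
  exact_mod_cast hcard

/-- A biorthogonal system extends to one with as many members as the dimension. -/
theorem exists_biorthogonal_complement {F S D : Type*} [Field F] [Fintype S] [Fintype D]
    [DecidableEq S] {n : ℕ} (hn : n = Fintype.card D - Fintype.card S) (x y : S → D → F)
    (h : ∀ i j, ∑ d, x i d * y j d = if i = j then 1 else 0) :
    ∃ z w : Fin n → D → F,
      (∀ i j, ∑ d, z i d * w j d = if i = j then 1 else 0) ∧
      (∀ i j, ∑ d, z i d * y j d = 0) ∧ ∀ i j, ∑ d, x i d * w j d = 0 := by
  classical
  -- `L` pairs with the `y`, `M` combines the `x`, and `L ∘ M = id`. The new vectors `z` are a basis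
  -- of `ker L`; the `w` represent its coordinates composed with the projection `id - M ∘ L`.
  let L : (D → F) →ₗ[F] (S → F) := (Matrix.of y).mulVecLin
  have hL : ∀ v j, L v j = ∑ d, v d * y j d := fun v j => by
    simp [L, Matrix.mulVec, dotProduct, mul_comm]
  let M : (S → F) →ₗ[F] (D → F) := (Matrix.of x).transpose.mulVecLin
  have hM : ∀ c, M c = ∑ i, c i • x i := fun c => by
    ext d
    simp [M, Matrix.vecMul, dotProduct]
  have hLx : ∀ i, L (x i) = Pi.single i 1 := fun i => by
    ext j
    rw [hL, h, Pi.single_apply]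
    simp [eq_comm]
  have hLM : ∀ c, L (M c) = c := fun c => by
    rw [hM, map_sum]
    simp only [map_smul, hLx]
    ext j
    simp [Finset.sum_apply, Pi.single_apply]
  have hMx : ∀ i, M (Pi.single i 1) = x i := fun i => by
    rw [hM]
    simp [Pi.single_apply]
  have hsurj : Function.Surjective L := fun c => ⟨M c, hLM c⟩
  have hfin : Module.finrank F (LinearMap.ker L) = n := by
    have h1 := LinearMap.finrank_range_add_finrank_ker L
    rw [LinearMap.range_eq_top.2 hsurj, finrank_top, Module.finrank_fintype_fun_eq_card,
      Module.finrank_fintype_fun_eq_card] at h1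
    omega
  let b := Module.finBasisOfFinrankEq F (LinearMap.ker L) hfin
  let P : (D → F) →ₗ[F] LinearMap.ker L :=
    (LinearMap.id - M ∘ₗ L).codRestrict (LinearMap.ker L) fun v => by
      simp [hLM]
  have hPker : ∀ v : LinearMap.ker L, P v = v := fun v => by
    ext1
    simp [P]
  have hPx : ∀ i, P (x i) = 0 := fun i => by
    ext1
    simp [P, hLx, hMx]
  have hw : ∀ j v, ∑ d, v d * b.coord j (P (Pi.single d 1)) = b.coord j (P v) := fun j v => by
    have := LinearMap.pi_apply_eq_sum_univ (b.coord j ∘ₗ P) v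
    have hs : ∀ d : D, (Pi.single d 1 : D → F) = fun i => if d = i then 1 else 0 := fun d => by
      ext i
      simp [Pi.single_apply, eq_comm]
    simpa [hs] using this.symm
  refine ⟨fun i => (b i : D → F), fun j d => b.coord j (P (Pi.single d 1)), fun i j => ?_,
    fun i j => ?_, fun i j => ?_⟩
  · rw [hw, hPker]
    simp [Finsupp.single_apply]
  · rw [← hL]
    exact congrFun (LinearMap.mem_ker.1 (b i).2) j
  · rw [hw, hPx, map_zero]

/-! ### Scenarios from orthogonality relations -/

/-- The scenario with a vertex for each `t : T` and one for each `R`-clique `s`, whose edges are the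
cliques `s`, each completed by its own vertex. -/
noncomputable def ofRel (T : Type) [Fintype T] (R : T → T → Prop) : ContextualityScenario where
  V := T ⊕ {s : Finset T // (s : Set T).Pairwise R}
  fintypeV := by classical exact inferInstance
  edges := {e | ∃ s : {s : Finset T // (s : Set T).Pairwise R}, e = s.1.disjSum {s}}
  covers := by
    rintro (t | s)
    · exact ⟨_, ⟨⟨{t}, by simp⟩, rfl⟩, Finset.inl_mem_disjSum.2 (Finset.mem_singleton_self t)⟩
    · exact ⟨_, ⟨s, rfl⟩, Finset.inr_mem_disjSum.2 (Finset.mem_singleton_self s)⟩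

/-- The multiplicities of the vertices of `ofRel T R` in dimension `n`. -/
noncomputable def ofRelMult (T : Type) [Fintype T] (R : T → T → Prop) (n : ℕ) : (ofRel T R).V → ℕ :=
  Sum.elim (fun _ => 1) fun s => n - s.1.card

/-- The model on `ofRel T R` that gives weight `1 / n` to every `t : T`. -/
noncomputable def ofRelModel (T : Type) [Fintype T] (R : T → T → Prop) (n : ℕ) :
    (ofRel T R).V → ℝ :=
  fun v => (ofRelMult T R n v : ℝ) / n

theorem orth_ofRel_inl {T : Type} [Fintype T] {R : T → T → Prop} (hR : ∀ a b, R a b → R b a)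
    {a b : T} (hne : a ≠ b) (h : R a b) : (ofRel T R).Orth (Sum.inl a) (Sum.inl b) := by
  classical
  refine ⟨fun h => hne (Sum.inl_injective h), _, ⟨⟨{a, b}, ?_⟩, rfl⟩,
    Finset.inl_mem_disjSum.2 (by simp), Finset.inl_mem_disjSum.2 (by simp)⟩
  rw [Finset.coe_pair, Set.pairwise_pair]
  exact fun _ => ⟨h, hR _ _ h⟩

/-- Represent `t` by the pair `x t`, `y t`, and the vertex completing a clique by a biorthogonal
complement of that clique's vectors. The multiplicities on each edge then add up to the dimension,
and Haemers' bound applies. -/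
theorem ofRelModel_mem_CEInf {T F D : Type} [Fintype T] {R : T → T → Prop} [Field F] [Fintype D]
    [Nonempty D] (x y : T → D → F) (hself : ∀ t, ∑ d, x t d * y t d = 1)
    (horth : ∀ s t, R s t → ∑ d, x s d * y t d = 0) :
    ofRelModel T R (Fintype.card D) ∈ (ofRel T R).CEInf := by
  classical
  have hD : (0 : ℝ) < Fintype.card D := by exact_mod_cast Fintype.card_pos
  have hbi : ∀ s : {s : Finset T // (s : Set T).Pairwise R}, ∀ i j : s.1,
      ∑ d, x i d * y j d = if i = j then 1 else 0 := fun s i j => by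
    split_ifs with hij
    · rw [hij, hself]
    · exact horth _ _ (s.2 i.2 j.2 fun h => hij (Subtype.ext h))
  -- Cliques fit into the dimension, so the subtraction in `ofRelMult` is not truncated.
  have hcard : ∀ s : {s : Finset T // (s : Set T).Pairwise R}, s.1.card ≤ Fintype.card D :=
    fun s => by simpa using card_le_card_of_biorthogonal _ _ (hbi s)
  have hcompl : ∀ s : {s : Finset T // (s : Set T).Pairwise R},
      ∃ z w : Fin (Fintype.card D - s.1.card) → D → F,
      (∀ i j, ∑ d, z i d * w j d = if i = j then 1 else 0) ∧
      (∀ i, ∀ t ∈ s.1, ∑ d, z i d * y t d = 0) ∧ ∀ t ∈ s.1, ∀ j, ∑ d, x t d * w j d = 0 :=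
    fun s => by
      obtain ⟨z, w, h1, h2, h3⟩ := exists_biorthogonal_complement
        (congrArg _ (Fintype.card_coe s.1).symm) _ _ (hbi s)
      exact ⟨z, w, h1, fun i t ht => h2 i ⟨t, ht⟩, fun t ht j => h3 ⟨t, ht⟩ j⟩
  choose z w h1 h2 h3 using hcompl
  refine mem_CEInf_iff.2 ⟨⟨fun v => ⟨by unfold ofRelModel; positivity, ?_⟩, ?_⟩, ?_⟩
  · refine div_le_one_of_le₀ (Nat.cast_le.2 ?_) hD.le
    rcases v with t | s
    · exact Fintype.card_pos
    · exact Nat.sub_le _ _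
  · rintro e ⟨s, rfl⟩
    refine (Finset.sum_disjSum _ _ _).trans ?_
    rw [Finset.sum_singleton]
    simp only [ofRelModel, ofRelMult, Sum.elim_inl, Sum.elim_inr, Finset.sum_const,
      nsmul_eq_mul, Nat.cast_one, Nat.cast_sub (hcard s)]
    field_simp
    ring
  · refine capacityLeOne_of_biorthogonal (F := F) (D := D) (ofRelMult T R (Fintype.card D))
      (fun v => match v with
        | Sum.inl t => fun _ => x t
        | Sum.inr s => z s)
      (fun v => match v with
        | Sum.inl t => fun _ => y t
        | Sum.inr s => w s) ?_ ?_
    · rintro (t | s) i j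
      · have hij : i = j := Subsingleton.elim (α := Fin 1) i j
        rw [if_pos hij]
        exact hself t
      · exact h1 s i j
    · rintro u v ⟨hne, e, ⟨s, rfl⟩, hu, hv⟩ i j
      rcases u with t | s₁ <;> rcases v with t' | s₂
      · exact horth _ _ (s.2 (Finset.inl_mem_disjSum.1 hu) (Finset.inl_mem_disjSum.1 hv)
          fun h => hne (congrArg _ h))
      · obtain rfl := Finset.mem_singleton.1 (Finset.inr_mem_disjSum.1 hv)
        exact h3 _ _ (Finset.inl_mem_disjSum.1 hu) j
      · obtain rfl := Finset.mem_singleton.1 (Finset.inr_mem_disjSum.1 hu)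
        exact h2 _ i _ (Finset.inl_mem_disjSum.1 hv)
      · obtain rfl := Finset.mem_singleton.1 (Finset.inr_mem_disjSum.1 hu)
        exact (hne (congrArg _ (Finset.mem_singleton.1 (Finset.inr_mem_disjSum.1 hv)).symm)).elim

theorem tensorModel_ofRelModel_notMem_CE1 {T : Type} [Fintype T] {RA RB : T → T → Prop}
    (hA : ∀ a b, RA a b → RA b a) (hB : ∀ a b, RB a b → RB b a)
    (h : ∀ a b, a ≠ b → RA a b ∨ RB a b) {m n : ℕ} (hmn : m * n < Fintype.card T)
    (hm : 0 < m) (hn : 0 < n) :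
    tensorModel (ofRelModel T RA m) (ofRelModel T RB n) ∉
      ((ofRel T RA).tensor (ofRel T RB)).CE1 := by
  classical
  rintro ⟨-, hI⟩
  -- The diagonal is pairwise orthogonal, with `card T` vertices of weight `1 / (m * n)` each.
  let g : T ↪ ((ofRel T RA).tensor (ofRel T RB)).V :=
    ⟨fun t => (Sum.inl t, Sum.inl t), fun s t hst => Sum.inl_injective (congrArg Prod.fst hst)⟩
  have key := hI (Finset.univ.map g) (by
    rw [isIndepSet_nonOrthogonalityGraph_iff]
    rintro _ ha _ hb hne
    obtain ⟨a, -, rfl⟩ := Finset.mem_map.1 (Finset.mem_coe.1 ha)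
    obtain ⟨b, -, rfl⟩ := Finset.mem_map.1 (Finset.mem_coe.1 hb)
    have hab : a ≠ b := fun h => hne (congrArg g h)
    exact (orth_tensor_iff _ _ _ _).2
      ((h a b hab).imp (orth_ofRel_inl hA hab) (orth_ofRel_inl hB hab)))
  rw [Finset.sum_map] at key
  have hval : ∀ t, tensorModel (ofRelModel T RA m) (ofRelModel T RB n) (g t) =
      1 / ((m * n : ℕ) : ℝ) := fun t => by
    change ((1 : ℕ) : ℝ) / m * (((1 : ℕ) : ℝ) / n) = _
    push_cast
    field_simp
  simp only [hval, Finset.sum_const, Finset.card_univ, nsmul_eq_mul, mul_one_div] at key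
  have hpos : (0 : ℝ) < ((m * n : ℕ) : ℝ) := by exact_mod_cast Nat.mul_pos hm hn
  rw [div_le_one hpos] at key
  exact absurd (Nat.cast_le.1 key) hmn.not_ge

/-- Activation, witnessed by the three-element subsets of a nine-element set: two of them are
orthogonal over `ZMod 2` if they meet in an even number of points, and the relation of meeting in
exactly one point is represented over `ℚ`. -/
theorem exists_activation : ∃ (HA HB : ContextualityScenario) (pA : HA.V → ℝ) (pB : HB.V → ℝ),
    pA ∈ HA.CEInf ∧ pB ∈ HB.CEInf ∧ tensorModel pA pB ∉ (HA.tensor HB).CE1 := by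
  classical
  let T := {s : Finset (Fin 9) // s.card = 3}
  let RA : T → T → Prop := fun s t => Even (s.1 ∩ t.1).card
  let RB : T → T → Prop := fun s t => (s.1 ∩ t.1).card = 1
  have hsum : ∀ (F : Type) [Field F] (s t : T), ∑ d : Fin 9,
      (if d ∈ s.1 then (1 : F) else 0) * (if d ∈ t.1 then 1 else 0) = (s.1 ∩ t.1).card :=
    fun F _ s t => by
      simp only [ite_zero_mul_ite_zero, one_mul, ← Finset.mem_inter, Finset.sum_boole,
        Finset.filter_univ_mem]
  have hsum' : ∀ s : T, ∑ d : Fin 9, (if d ∈ s.1 then (1 : ℚ) else 0) = 3 := fun s => by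
    simp [s.2]
  -- The dual vector is shifted and scaled so that the pairing is 1 for intersection size 3 and 0
  -- for size 1.
  have hQ : ∀ s t : T, ∑ d : Fin 9, (if d ∈ s.1 then (1 : ℚ) else 0) *
      (((if d ∈ t.1 then 1 else 0) - 1 / 3) / 2) = ((s.1 ∩ t.1).card - 1) / 2 := fun s t => by
    rw [← hsum ℚ s t, sub_div, Finset.sum_div]
    have : (1 : ℚ) / 2 = ∑ d : Fin 9, (if d ∈ s.1 then (1 : ℚ) else 0) * (1 / 6) := by
      rw [← Finset.sum_mul, hsum']
      norm_num
    rw [this, ← Finset.sum_sub_distrib]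
    exact Finset.sum_congr rfl fun d _ => by ring
  refine ⟨ofRel T RA, ofRel T RB, ofRelModel T RA (Fintype.card (Fin 9)),
    ofRelModel T RB (Fintype.card (Fin 9)), ?_, ?_, ?_⟩
  · refine ofRelModel_mem_CEInf (F := ZMod 2) (fun s d => if d ∈ s.1 then 1 else 0)
      (fun s d => if d ∈ s.1 then 1 else 0) (fun s => ?_) (fun s t hst => ?_)
    · rw [hsum, Finset.inter_self, s.2]
      rfl
    · rw [hsum]
      exact ZMod.natCast_eq_zero_iff_even.2 hst
  · refine ofRelModel_mem_CEInf (F := ℚ) (fun s d => if d ∈ s.1 then 1 else 0)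
      (fun s d => ((if d ∈ s.1 then 1 else 0) - 1 / 3) / 2) (fun s => ?_) (fun s t hst => ?_)
    · rw [hQ, Finset.inter_self, s.2]
      norm_num
    · have : (s.1 ∩ t.1).card = 1 := hst
      rw [hQ, this]
      norm_num
  · refine tensorModel_ofRelModel_notMem_CE1 (fun s t h => ?_) (fun s t h => ?_)
      (fun s t hne => ?_) ?_ (by simp) (by simp)
    · simpa only [RA, Finset.inter_comm] using h
    · simpa only [RB, Finset.inter_comm] using h
    · have hlt : (s.1 ∩ t.1).card < 3 := by
        refine lt_of_lt_of_eq ?_ s.2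
        refine Finset.card_lt_card (Finset.inter_subset_left.ssubset_of_ne fun h => hne ?_)
        exact Subtype.ext (Finset.eq_of_subset_of_card_le (Finset.inter_eq_left.1 h)
          (by rw [s.2, t.2]))
      simp only [RA, RB]
      generalize (s.1 ∩ t.1).card = c at hlt
      interval_cases c <;> simp
    · rw [Fintype.card_finset_len]
      simp only [Fintype.card_fin]
      decide

end ContextualityScenario

theorem mainTheorem7 :
    -- there is a scenario whose set of models satisfying `CE^∞` is not convex
    (∃ H : ContextualityScenario, ¬ Convex ℝ H.CEInf) ∧
    -- there are scenarios and models that show activation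
    (∃ (HA HB : ContextualityScenario) (pA : HA.V → ℝ) (pB : HB.V → ℝ),
      pA ∈ HA.CEInf ∧ pB ∈ HB.CEInf ∧
        ContextualityScenario.tensorModel pA pB ∉ (HA.tensor HB).CE1) ∧
    -- and every such pair gives non-convexity on the disjoint union, by mixing half and half
    (∀ (HA HB : ContextualityScenario) (pA : HA.V → ℝ) (pB : HB.V → ℝ),
      pA ∈ HA.CEInf → pB ∈ HB.CEInf →
      ContextualityScenario.tensorModel pA pB ∉ (HA.tensor HB).CEInf →
      ∃ (hA : HA.edges.Nonempty) (hB : HB.edges.Nonempty),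
        ContextualityScenario.extendLeft pA ∈ (HA.disjointUnion HB hA hB).CEInf ∧
        ContextualityScenario.extendRight pB ∈ (HA.disjointUnion HB hA hB).CEInf ∧
        (1 / 2 : ℝ) • (ContextualityScenario.extendLeft pA +
          ContextualityScenario.extendRight pB) ∉ (HA.disjointUnion HB hA hB).CEInf ∧
        ¬ Convex ℝ (HA.disjointUnion HB hA hB).CEInf) := by
  have union : ∀ (HA HB : ContextualityScenario) (pA : HA.V → ℝ) (pB : HB.V → ℝ),
      pA ∈ HA.CEInf → pB ∈ HB.CEInf →
      ContextualityScenario.tensorModel pA pB ∉ (HA.tensor HB).CEInf →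
      ∃ (hA : HA.edges.Nonempty) (hB : HB.edges.Nonempty),
        ContextualityScenario.extendLeft pA ∈ (HA.disjointUnion HB hA hB).CEInf ∧
        ContextualityScenario.extendRight pB ∈ (HA.disjointUnion HB hA hB).CEInf ∧
        (1 / 2 : ℝ) • (ContextualityScenario.extendLeft pA +
          ContextualityScenario.extendRight pB) ∉ (HA.disjointUnion HB hA hB).CEInf ∧
        ¬ Convex ℝ (HA.disjointUnion HB hA hB).CEInf := by
    intro HA HB pA pB hpA hpB h
    obtain ⟨hA, hB⟩ := ContextualityScenario.edges_nonempty_of_tensorModel_notMem hpA hpB h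
    have hl := ContextualityScenario.extendLeft_mem_CEInf (hA := hA) (hB := hB) hpA
    have hr := ContextualityScenario.extendRight_mem_CEInf (hA := hA) (hB := hB) hpB
    have hm := ContextualityScenario.mix_notMem_CEInf (hA := hA) (hB := hB) hpA hpB h
    exact ⟨hA, hB, hl, hr, hm, ContextualityScenario.not_convex_CEInf_of_mix hl hr hm⟩
  obtain ⟨HA, HB, pA, pB, hpA, hpB, h⟩ := ContextualityScenario.exists_activation
  obtain ⟨hA, hB, -, -, -, hc⟩ := union HA HB pA pB hpA hpB
    fun h' => h (ContextualityScenario.CEInf_subset_CE1 _ h')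
  exact ⟨⟨_, hc⟩, ⟨HA, HB, pA, pB, hpA, hpB, h⟩, union⟩
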